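/- Let $a,b,c>0$ and let $v(x)=F(a,b;c;x)=\sum_{n\ge 0}\frac{(a)_n(b)_n}{(c)_n\,n!}x^n$, $|x|<1$, be the Gaussian hypergeometric function, where $(a)_n=a(a+1)\cdots(a+n-1)$. Put $$f(x)=x(1-x)\frac{v'(x)}{v(x)}\quad(-1<x<1),\qquad N(x)=x(1-x)\left[\frac{v'(x)}{v(x)}+\frac{v'(1-x)}{v(1-x)}\right]\quad(0<x<1).$$ (1) Suppose $\max\{a,b\}<c$. Then $f$ is represented on $(-1,1)$ by its Maclaurin series $\sum_{n\ge 0}A_nx^n$, whose coefficients satisfy $A_0=0$, $A_1>0$ and $A_n<0$ for all $n\ge 2$; moreover $f$ is positive and strictly concave on $(0,1)$. The function $N$ is positive on $(0,1)$, symmetric about $x=1/2$ (that is, $N(1-x)=N(x)$), strictly concave on $(0,1)$, strictly increasing on $(0,1/2]$ and strictly decreasing on $[1/2,1)$. (2) If $\max\{a,b\}=c$, then $N$ is a positive constant on $(0,1)$. -/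

import Mathlib

/-- The `n`-th Maclaurin coefficient of `f`. -/
noncomputable def maclaurinCoeff (f : ℝ → ℝ) (n : ℕ) : ℝ :=
  iteratedDeriv n f 0 / (n.factorial : ℝ)

/-- The function `x ↦ x (1 - x) v'(x) / v(x)`. -/
noncomputable def scaledLogDeriv (v : ℝ → ℝ) (x : ℝ) : ℝ :=
  x * (1 - x) * (deriv v x / v x)

/-- The function `N(x) = x (1 - x) [v'(x) / v(x) + v'(1 - x) / v(1 - x)]`. -/
noncomputable def symLogDeriv (v : ℝ → ℝ) (x : ℝ) : ℝ :=
  x * (1 - x) * (deriv v x / v x + deriv v (1 - x) / v (1 - x))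

/-! Write `H = (1 - x) v' / v`, so that `f = x H`. The hypergeometric equation turns into a Riccati
equation for `H`, and hence into a quadratic recurrence for its coefficients `h n`
(`coeff_reducedLogDeriv_succ`). It gives `h 0 = a b / c`, and `h 1` is a negative multiple of `(c -
a) (c - b)`. Moving the two end terms `2 * h 0 * h n` of the convolution into the linear term leaves
a positive multiple of `h n` minus products of earlier coefficients of positive index. By induction
all `h n` with `n ≥ 1` are negative if `max a b < c`, and all vanish if `max a b = c`.

These signs also give convergence: comparing coefficients in `H V = (1 - X) V'` bounds `|h n|` by
`(h 0 + n)` times the coefficient of `V`. Then `v' = H v / (1 - x)` forces `v ≠ 0` on `(-1, 1)`, so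
`f` is the sum of `X H` there. Concavity of `f` holds term by term, and `N x = f x + f (1 - x)`
inherits it. In the equality case `f x = x a b / c`, so `N` is the constant `a b / c`. -/

open PowerSeries

/-- The power series of the Gaussian hypergeometric function. -/
noncomputable def hypergeomSeries (a b c : ℝ) : ℝ⟦X⟧ :=
  PowerSeries.mk (ordinaryHypergeometricCoefficient a b c)

/-- The power series `(1 - X) V' / V` of a power series `V`. -/
noncomputable def reducedLogDeriv (V : ℝ⟦X⟧) : ℝ⟦X⟧ :=
  (1 - X) * d⁄dX ℝ V * V⁻¹

/-! ### Coefficients and differential equation of the hypergeometric series -/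

theorem coeff_hypergeomSeries_zero (a b c : ℝ) : coeff 0 (hypergeomSeries a b c) = 1 := by
  simp [hypergeomSeries, ordinaryHypergeometricCoefficient]

theorem coeff_hypergeomSeries_succ {a b c : ℝ} (hc : 0 < c) (n : ℕ) :
    (n + 1) * (n + c) * coeff (n + 1) (hypergeomSeries a b c) =
      (n + a) * (n + b) * coeff n (hypergeomSeries a b c) := by
  have h1 : (ascPochhammer ℝ n).eval c ≠ 0 := (ascPochhammer_pos n c hc).ne'
  have h2 : (n : ℝ) + c ≠ 0 := by positivity
  have h2' : c + (n : ℝ) ≠ 0 := by positivity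
  have h3 : ((n.factorial : ℕ) : ℝ) ≠ 0 := by positivity
  have h4 : (n : ℝ) + 1 ≠ 0 := by positivity
  simp only [hypergeomSeries, coeff_mk, ordinaryHypergeometricCoefficient, ascPochhammer_succ_eval,
    Nat.factorial_succ, Nat.cast_mul, Nat.cast_add, Nat.cast_one]
  field_simp
  ring

theorem coeff_hypergeomSeries_pos {a b c : ℝ} (ha : 0 < a) (hb : 0 < b) (hc : 0 < c) (n : ℕ) :
    0 < coeff n (hypergeomSeries a b c) := by
  have h1 := ascPochhammer_pos n a ha
  have h2 := ascPochhammer_pos n b hb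
  have h3 := ascPochhammer_pos n c hc
  simp only [hypergeomSeries, coeff_mk, ordinaryHypergeometricCoefficient]
  positivity

theorem coeff_X_mul_derivative (P : ℝ⟦X⟧) (n : ℕ) :
    coeff n (X * d⁄dX ℝ P) = n * coeff n P := by
  cases n with
  | zero => simp
  | succ n => rw [coeff_succ_X_mul, coeff_derivative]; push_cast; ring

/-- The hypergeometric differential equation. -/
theorem hypergeomSeries_ode {a b c : ℝ} (hc : 0 < c) :
    X * (1 - X) * d⁄dX ℝ (d⁄dX ℝ (hypergeomSeries a b c)) +
      (C c - C (a + b + 1) * X) * d⁄dX ℝ (hypergeomSeries a b c) =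
      C (a * b) * hypergeomSeries a b c := by
  set V := hypergeomSeries a b c with hV
  have e : X * (1 - X) * d⁄dX ℝ (d⁄dX ℝ V) + (C c - C (a + b + 1) * X) * d⁄dX ℝ V
      = X * d⁄dX ℝ (d⁄dX ℝ V) - X * (X * d⁄dX ℝ (d⁄dX ℝ V)) + C c * d⁄dX ℝ V
        - C (a + b + 1) * (X * d⁄dX ℝ V) := by ring
  rw [e]
  -- Hiding the sum behind `s` keeps `map_add` from splitting the constant `C (a + b + 1)`.
  obtain ⟨s, hs⟩ : ∃ s, s = a + b + 1 := ⟨_, rfl⟩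
  rw [← hs]
  ext n
  have r := coeff_hypergeomSeries_succ (a := a) (b := b) hc n
  rw [← hV] at r
  simp only [map_add, map_sub, coeff_C_mul, coeff_X_mul_derivative]
  cases n with
  | zero =>
    simp only [coeff_zero_X_mul, coeff_derivative] at *
    push_cast at *
    subst hs
    linear_combination r
  | succ n =>
    simp only [coeff_succ_X_mul, coeff_X_mul_derivative, coeff_derivative] at *
    push_cast at *
    subst hs
    linear_combination r

/-! ### Riccati equation and signs of the coefficients of `(1 - X) V' / V` -/

theorem reducedLogDeriv_mul_self {V : ℝ⟦X⟧} (hV : coeff 0 V = 1) :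
    reducedLogDeriv V * V = (1 - X) * d⁄dX ℝ V := by
  rw [reducedLogDeriv, mul_assoc, PowerSeries.inv_mul_cancel, mul_one]
  rw [← coeff_zero_eq_constantCoeff_apply, hV]
  exact one_ne_zero

theorem reducedLogDeriv_riccati {a b c : ℝ} (hc : 0 < c) :
    X * d⁄dX ℝ (reducedLogDeriv (hypergeomSeries a b c)) -
      X * (X * d⁄dX ℝ (reducedLogDeriv (hypergeomSeries a b c))) +
      X * (reducedLogDeriv (hypergeomSeries a b c) * reducedLogDeriv (hypergeomSeries a b c)) =
      C (a * b) * 1 - C (a * b) * X - C c * reducedLogDeriv (hypergeomSeries a b c) +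
      C (a + b) * (X * reducedLogDeriv (hypergeomSeries a b c)) := by
  have h0 := coeff_hypergeomSeries_zero a b c
  have hH := reducedLogDeriv_mul_self h0
  have ode := hypergeomSeries_ode (a := a) (b := b) hc
  set V := hypergeomSeries a b c with hV
  set H := reducedLogDeriv V
  have hV0 : V ≠ 0 := by
    intro h
    rw [h] at h0
    simp at h0
  have hd := congrArg (d⁄dX ℝ) hH
  simp only [Derivation.leibniz, smul_eq_mul, map_sub, derivative_X, Derivation.map_one_eq_zero]
    at hd
  apply mul_right_cancel₀ hV0
  have hCs : (C (a + b + 1) : ℝ⟦X⟧) = C (a + b) + 1 := by simp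
  rw [hCs] at ode
  -- After multiplication by `V`, the differentiated relation `hd` brings in `V''`, the differential
  -- equation removes it, and `hH` removes `V'`.
  linear_combination X * (1 - X) * hd + (1 - X) * ode + (C c - C (a + b) * X + X * H) * hH

theorem coeff_reducedLogDeriv_zero {a b c : ℝ} (hc : 0 < c) :
    coeff 0 (reducedLogDeriv (hypergeomSeries a b c)) = a * b / c := by
  have h := congrArg (coeff 0) (reducedLogDeriv_riccati (a := a) (b := b) hc)
  generalize a + b = s at h
  simp only [map_add, map_sub, coeff_zero_X_mul, coeff_C_mul, coeff_zero_one, coeff_zero_X] at h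
  field_simp
  linarith

theorem coeff_reducedLogDeriv_succ {a b c : ℝ} (hc : 0 < c) (k : ℕ) :
    (k + 1 + c) * coeff (k + 1) (reducedLogDeriv (hypergeomSeries a b c)) =
      (k + (a + b)) * coeff k (reducedLogDeriv (hypergeomSeries a b c)) -
      a * b * (if k = 0 then 1 else 0) -
      ∑ p ∈ Finset.HasAntidiagonal.antidiagonal k,
        coeff p.1 (reducedLogDeriv (hypergeomSeries a b c)) *
        coeff p.2 (reducedLogDeriv (hypergeomSeries a b c)) := by
  have h := congrArg (coeff (k + 1)) (reducedLogDeriv_riccati (a := a) (b := b) hc)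
  generalize a + b = s at h ⊢
  simp only [map_add, map_sub, coeff_succ_X_mul, coeff_X_mul_derivative,
    coeff_C_mul] at h
  rw [coeff_mul, coeff_derivative, coeff_one, if_neg k.succ_ne_zero, coeff_X] at h
  simp only [Nat.add_eq_right] at h
  linear_combination h

theorem coeff_reducedLogDeriv_one {a b c : ℝ} (hc : 0 < c) :
    (1 + c) * coeff 1 (reducedLogDeriv (hypergeomSeries a b c)) =
      -((a * b / c) * ((c - a) * (c - b) / c)) := by
  have h := coeff_reducedLogDeriv_succ (a := a) (b := b) hc 0
  simp only [Finset.Nat.antidiagonal_zero, Finset.sum_singleton, coeff_reducedLogDeriv_zero hc,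
    if_true, Nat.cast_zero, zero_add] at h
  have e : (a * b / c) * ((c - a) * (c - b) / c) =
    a * b - (a + b) * (a * b / c) + (a * b / c) * (a * b / c) := by field_simp; ring
  linear_combination h + e

/-- Both `a * b / c ≤ a` and `a * b / c ≤ b` hold. This keeps the linear factor of the recurrence
positive once `2 * h 0` has been absorbed into it. -/
theorem two_mul_div_le_add {a b c : ℝ} (ha : 0 < a) (hb : 0 < b) (hc : 0 < c)
    (hac : a ≤ c) (hbc : b ≤ c) : 2 * (a * b / c) ≤ a + b := by
  have h : a * b / c * 2 = (a * b * 2) / c := by ring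
  rw [mul_comm, h, div_le_iff₀ hc]
  nlinarith

/-- The end terms of the convolution join the linear term. The remaining products involve only
coefficients of positive index, so negative coefficients make the sum nonnegative. -/
theorem coeff_reducedLogDeriv_add_three {a b c : ℝ} (hc : 0 < c) (k : ℕ) :
    (k + 3 + c) * coeff (k + 3) (reducedLogDeriv (hypergeomSeries a b c)) =
      (k + 2 + (a + b - 2 * (a * b / c))) *
        coeff (k + 2) (reducedLogDeriv (hypergeomSeries a b c)) -
      ∑ p ∈ Finset.HasAntidiagonal.antidiagonal k, coeff (p.1 + 1) (reducedLogDeriv (hypergeomSeries a b c)) *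
        coeff (p.2 + 1) (reducedLogDeriv (hypergeomSeries a b c)) := by
  have h := coeff_reducedLogDeriv_succ (a := a) (b := b) hc (k + 2)
  rw [Finset.Nat.antidiagonal_succ_succ', if_neg (by omega)] at h
  simp only [Finset.sum_cons, Finset.sum_map, Function.Embedding.prodMap,
    Function.Embedding.coeFn_mk, Prod.map, Nat.succ_eq_add_one,
    coeff_reducedLogDeriv_zero hc] at h
  push_cast at h
  linear_combination h

theorem coeff_reducedLogDeriv_two {a b c : ℝ} (hc : 0 < c) :
    (2 + c) * coeff 2 (reducedLogDeriv (hypergeomSeries a b c)) =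
      (1 + (a + b - 2 * (a * b / c))) *
        coeff 1 (reducedLogDeriv (hypergeomSeries a b c)) := by
  have h := coeff_reducedLogDeriv_succ (a := a) (b := b) hc 1
  rw [Finset.Nat.antidiagonal_succ, if_neg one_ne_zero] at h
  simp [-coeff_zero_eq_constantCoeff, coeff_reducedLogDeriv_zero hc] at h
  linear_combination h

theorem coeff_reducedLogDeriv_neg {a b c : ℝ} (ha : 0 < a) (hb : 0 < b) (hc : 0 < c)
    (hac : a < c) (hbc : b < c) (n : ℕ) :
    coeff (n + 1) (reducedLogDeriv (hypergeomSeries a b c)) < 0 := by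
  have hab := two_mul_div_le_add ha hb hc hac.le hbc.le
  induction n using Nat.strong_induction_on with
  | _ n ih =>
    match n, ih with
    | 0, _ =>
      have h := coeff_reducedLogDeriv_one (a := a) (b := b) hc
      have h1 : 0 < (a * b / c) * ((c - a) * (c - b) / c) := by
        have := sub_pos.2 hac
        have := sub_pos.2 hbc
        positivity
      exact (pos_iff_neg_of_mul_neg (by linarith)).1 (by positivity : 0 < 1 + c)
    | 1, ih =>
      have h := coeff_reducedLogDeriv_two (a := a) (b := b) hc
      have h1 := mul_neg_of_pos_of_neg
        (by linarith : 0 < 1 + (a + b - 2 * (a * b / c))) (ih 0 (by norm_num))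
      rw [zero_add, ← h] at h1
      exact (pos_iff_neg_of_mul_neg h1).1 (by positivity : 0 < 2 + c)
    | k + 2, ih =>
      have h := coeff_reducedLogDeriv_add_three (a := a) (b := b) hc k
      have hk : (0 : ℝ) ≤ k := k.cast_nonneg
      have h1 := mul_neg_of_pos_of_neg
        (by linarith : 0 < k + 2 + (a + b - 2 * (a * b / c))) (ih (k + 1) (by norm_num))
      have h2 : 0 ≤ ∑ p ∈ Finset.HasAntidiagonal.antidiagonal k,
          coeff (p.1 + 1) (reducedLogDeriv (hypergeomSeries a b c)) *
          coeff (p.2 + 1) (reducedLogDeriv (hypergeomSeries a b c)) := by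
        refine Finset.sum_nonneg fun p hp => ?_
        have hp' := Finset.HasAntidiagonal.mem_antidiagonal.1 hp
        exact mul_nonneg_of_nonpos_of_nonpos (ih p.1 (by omega)).le (ih p.2 (by omega)).le
      exact (pos_iff_neg_of_mul_neg (a := (k : ℝ) + 3 + c) (by rw [h]; linarith)).1 (by positivity)

theorem coeff_reducedLogDeriv_eq_zero {a b c : ℝ} (hc : 0 < c) (h : max a b = c) (n : ℕ) :
    coeff (n + 1) (reducedLogDeriv (hypergeomSeries a b c)) = 0 := by
  have hcab : (c - a) * (c - b) = 0 := by
    rcases max_choice a b with h' | h' <;> rw [h'] at h <;> simp [h]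
  induction n using Nat.strong_induction_on with
  | _ n ih =>
    match n, ih with
    | 0, _ =>
      have h := coeff_reducedLogDeriv_one (a := a) (b := b) hc
      rw [hcab, zero_div, mul_zero, neg_zero] at h
      exact (mul_eq_zero.1 h).resolve_left (by positivity)
    | 1, ih =>
      have h := coeff_reducedLogDeriv_two (a := a) (b := b) hc
      rw [show coeff 1 (reducedLogDeriv (hypergeomSeries a b c)) = 0 from ih 0 (by norm_num),
        mul_zero] at h
      exact (mul_eq_zero.1 h).resolve_left (by positivity)
    | k + 2, ih =>
      have h := coeff_reducedLogDeriv_add_three (a := a) (b := b) hc k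
      rw [ih (k + 1) (by norm_num), mul_zero, Finset.sum_eq_zero, sub_zero] at h
      · exact (mul_eq_zero.1 h).resolve_left (by positivity)
      · intro p hp
        have hp' := Finset.HasAntidiagonal.mem_antidiagonal.1 hp
        rw [ih p.1 (by omega), zero_mul]

/-- In the coefficient of `X ^ (n + 1)` in `H V = (1 - X) V'`, all terms of the convolution except
the one with `h 0` are nonpositive, so none of them can be large: each is controlled by the
coefficients of `V`. -/
theorem abs_coeff_reducedLogDeriv_le {V : ℝ⟦X⟧} (hV : coeff 0 V = 1) (hpos : ∀ n, 0 < coeff n V)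
    (h0 : 0 ≤ coeff 0 (reducedLogDeriv V)) (hneg : ∀ n, coeff (n + 1) (reducedLogDeriv V) ≤ 0)
    (n : ℕ) :
    |coeff n (reducedLogDeriv V)| ≤ coeff 0 (reducedLogDeriv V) * coeff n V + n * coeff n V := by
  cases n with
  | zero => rw [abs_of_nonneg h0, hV]; simp
  | succ n =>
    rw [abs_of_nonpos (hneg n)]
    have h := congrArg (coeff (n + 1)) (reducedLogDeriv_mul_self hV)
    rw [sub_mul, one_mul, map_sub, coeff_X_mul_derivative, coeff_derivative, coeff_mul,
      Finset.Nat.antidiagonal_succ, Finset.sum_cons, Finset.sum_map] at h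
    have h2 : ∑ p ∈ Finset.HasAntidiagonal.antidiagonal n, coeff (p.1 + 1) (reducedLogDeriv V) * coeff p.2 V ≤
        coeff (n + 1) (reducedLogDeriv V) * coeff 0 V := by
      have h5 := Finset.single_le_sum
        (f := fun p : ℕ × ℕ => -(coeff (p.1 + 1) (reducedLogDeriv V) * coeff p.2 V))
        (s := Finset.HasAntidiagonal.antidiagonal n) (a := (n, 0))
        (fun p _ => neg_nonneg.2 (mul_nonpos_of_nonpos_of_nonneg (hneg p.1) (hpos p.2).le))
        (by simp)
      rw [Finset.sum_neg_distrib] at h5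
      exact neg_le_neg_iff.1 h5
    have h3 := hpos (n + 2)
    have h4 : 0 ≤ ((n + 1 : ℕ) + 1 : ℝ) * coeff (n + 1 + 1) V := by positivity
    simp only [Function.Embedding.prodMap, Function.Embedding.coeFn_mk, Prod.map,
      Nat.succ_eq_add_one, Function.Embedding.refl_apply] at h
    rw [hV] at h2
    linarith

/-! ### Sums, derivatives and products of power series on `(-1, 1)` -/

/-- A real power series is unit-convergent if it converges absolutely on `(-1, 1)`. -/
def UnitConvergent (P : ℝ⟦X⟧) : Prop :=
  ∀ x : ℝ, |x| < 1 → Summable fun n => ‖coeff n P * x ^ n‖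

/-- The sum of a real power series. -/
noncomputable def seriesSum (P : ℝ⟦X⟧) (x : ℝ) : ℝ :=
  ∑' n, coeff n P * x ^ n

theorem UnitConvergent.hasSum {P : ℝ⟦X⟧} (h : UnitConvergent P) {x : ℝ} (hx : |x| < 1) :
    HasSum (fun n => coeff n P * x ^ n) (seriesSum P x) :=
  (h x hx).of_norm.hasSum

theorem seriesSum_zero (P : ℝ⟦X⟧) : seriesSum P 0 = coeff 0 P := by
  rw [seriesSum, tsum_eq_single 0]
  · simp
  · intro n hn
    simp [hn]

theorem unitConvergent_of_one_le_radius {P : ℝ⟦X⟧}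
    (h : 1 ≤ (FormalMultilinearSeries.ofScalars ℝ (fun n => coeff n P)).radius) :
    UnitConvergent P := by
  intro x hx
  have := FormalMultilinearSeries.summable_norm_apply
    (FormalMultilinearSeries.ofScalars ℝ (fun n => coeff n P)) (x := x) (by
      rw [mem_eball_zero_iff]
      refine lt_of_lt_of_le ?_ h
      rw [← ofReal_norm, Real.norm_eq_abs]
      simpa using hx)
  simpa [FormalMultilinearSeries.ofScalars_apply_eq, mul_comm] using this

theorem UnitConvergent.hasFPowerSeriesOnBall {P : ℝ⟦X⟧} (h : UnitConvergent P) :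
    HasFPowerSeriesOnBall (seriesSum P)
      (FormalMultilinearSeries.ofScalars ℝ (fun n => coeff n P)) 0 1 := by
  refine ⟨?_, one_pos, ?_⟩
  · refine ENNReal.le_of_forall_nnreal_lt fun r hr => ?_
    apply FormalMultilinearSeries.le_radius_of_summable
    have hr' : (r : ℝ) < 1 := by exact_mod_cast hr
    have := h r (by simpa using hr')
    simpa [FormalMultilinearSeries.ofScalars_norm, mul_comm] using this
  · intro y hy
    rw [mem_eball_zero_iff, ← ofReal_norm, Real.norm_eq_abs] at hy
    have hy' : |y| < 1 := by simpa using hy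
    simpa [FormalMultilinearSeries.ofScalars_apply_eq, mul_comm] using h.hasSum hy'

theorem UnitConvergent.analyticAt {P : ℝ⟦X⟧} (h : UnitConvergent P) {x : ℝ} (hx : |x| < 1) :
    AnalyticAt ℝ (seriesSum P) x :=
  h.hasFPowerSeriesOnBall.analyticAt_of_mem (by
    rw [mem_eball_zero_iff, ← ofReal_norm, Real.norm_eq_abs]
    simpa using hx)

theorem UnitConvergent.derivative_and_hasDerivAt {P : ℝ⟦X⟧} (h : UnitConvergent P) :
    UnitConvergent (d⁄dX ℝ P) ∧
      ∀ x : ℝ, |x| < 1 → HasDerivAt (seriesSum P) (seriesSum (d⁄dX ℝ P) x) x := by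
  have hf := h.hasFPowerSeriesOnBall.fderiv
  -- The Fréchet derivative's series takes values in linear maps; evaluation at `1` recovers the
  -- formal derivative.
  have key : ∀ (x : ℝ) (n : ℕ),
      (FormalMultilinearSeries.ofScalars ℝ (fun n => coeff n P)).derivSeries n (fun _ => x) 1 =
        coeff n (d⁄dX ℝ P) * x ^ n := by
    intro x n
    rw [FormalMultilinearSeries.apply_eq_pow_smul_coeff, smul_apply,
      FormalMultilinearSeries.derivSeries_coeff_one, coeff_derivative,
      FormalMultilinearSeries.coeff_ofScalars]
    simp
    ring
  have mem : ∀ x : ℝ, |x| < 1 → x ∈ Metric.eball (0 : ℝ) 1 := by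
    intro x hx
    rw [mem_eball_zero_iff, ← ofReal_norm, Real.norm_eq_abs]
    simpa using hx
  refine ⟨fun x hx => ?_, fun x hx => ?_⟩
  · have := FormalMultilinearSeries.summable_norm_apply _
      (Metric.eball_subset_eball hf.r_le (mem x hx))
    refine this.of_nonneg_of_le (fun _ => norm_nonneg _) fun n => ?_
    rw [← key]
    simpa using ContinuousLinearMap.le_opNorm ((FormalMultilinearSeries.ofScalars ℝ
      (fun n => coeff n P)).derivSeries n (fun _ => x)) 1
  · have hs := (hf.hasSum (mem x hx)).mapL (ContinuousLinearMap.apply ℝ ℝ (1 : ℝ))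
    simp only [ContinuousLinearMap.apply_apply, key, zero_add] at hs
    rw [fderiv_apply_one_eq_deriv] at hs
    rw [seriesSum, hs.tsum_eq]
    exact (h.analyticAt hx).differentiableAt.hasDerivAt

theorem UnitConvergent.mul {P Q : ℝ⟦X⟧} (hP : UnitConvergent P) (hQ : UnitConvergent Q) :
    UnitConvergent (P * Q) ∧
      ∀ x : ℝ, |x| < 1 → seriesSum (P * Q) x = seriesSum P x * seriesSum Q x := by
  have key : ∀ (x : ℝ) (n : ℕ), ∑ p ∈ Finset.HasAntidiagonal.antidiagonal n,
      (coeff p.1 P * x ^ p.1) * (coeff p.2 Q * x ^ p.2) = coeff n (P * Q) * x ^ n := by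
    intro x n
    rw [coeff_mul, Finset.sum_mul]
    refine Finset.sum_congr rfl fun p hp => ?_
    rw [← Finset.HasAntidiagonal.mem_antidiagonal.1 hp, pow_add]
    ring
  refine ⟨fun x hx => ?_, fun x hx => ?_⟩
  · simpa only [key] using summable_norm_sum_mul_antidiagonal_of_summable_norm (hP x hx) (hQ x hx)
  · rw [seriesSum, seriesSum, seriesSum,
      tsum_mul_tsum_eq_tsum_sum_antidiagonal_of_summable_norm (hP x hx) (hQ x hx)]
    exact tsum_congr fun n => (key x n).symm

theorem unitConvergent_X : UnitConvergent X := fun x _ =>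
  summable_of_ne_finset_zero (s := {1}) fun n hn => by
    rw [coeff_X, if_neg (by simpa using hn)]; simp

theorem seriesSum_X (x : ℝ) : seriesSum X x = x := by
  rw [seriesSum, tsum_eq_single 1]
  · simp
  · intro n hn
    rw [coeff_X, if_neg hn, zero_mul]

theorem unitConvergent_one_sub_X : UnitConvergent (1 - X) := fun x _ =>
  summable_of_ne_finset_zero (s := {0, 1}) fun n hn => by
    have hn' : n ≠ 0 ∧ n ≠ 1 := by simpa using hn
    rw [map_sub, coeff_X, coeff_one, if_neg hn'.1, if_neg hn'.2]; simp

theorem seriesSum_one_sub_X (x : ℝ) : seriesSum (1 - X) x = 1 - x := by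
  rw [seriesSum, tsum_eq_sum (s := {0, 1})]
  · simp [coeff_X, coeff_one]
    ring
  · intro n hn
    have hn' : n ≠ 0 ∧ n ≠ 1 := by simpa using hn
    rw [map_sub, coeff_X, coeff_one, if_neg hn'.1, if_neg hn'.2]; simp

theorem UnitConvergent.maclaurinCoeff_eq {P : ℝ⟦X⟧} (h : UnitConvergent P) {f : ℝ → ℝ}
    (hf : ∀ x ∈ Set.Ioo (-1 : ℝ) 1, f x = seriesSum P x) (n : ℕ) :
    maclaurinCoeff f n = coeff n P := by
  have e : f =ᶠ[nhds 0] seriesSum P :=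
    Filter.eventuallyEq_of_mem (Ioo_mem_nhds (by norm_num) (by norm_num)) hf
  -- Uniqueness of the power series at `0`: the Taylor series supplied by analyticity must agree
  -- with that of `P`.
  have h1 := (h.analyticAt (x := 0) (by simp)).hasFPowerSeriesAt.eq_formalMultilinearSeries
    h.hasFPowerSeriesOnBall.hasFPowerSeriesAt
  have h2 := congrFun (FormalMultilinearSeries.ofScalars_series_injective ℝ ℝ h1) n
  rw [maclaurinCoeff, e.iteratedDeriv_eq]
  exact h2

/-! ### Convergence, nonvanishing and concavity -/

theorem unitConvergent_hypergeomSeries {a b c : ℝ} (ha : 0 < a) (hb : 0 < b) (hc : 0 < c) :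
    UnitConvergent (hypergeomSeries a b c) := by
  apply unitConvergent_of_one_le_radius
  have h := ordinaryHypergeometricSeries_radius_eq_one ℝ a b c fun k => by
    have : (0 : ℝ) ≤ k := k.cast_nonneg
    refine ⟨?_, ?_, ?_⟩ <;> linarith
  simp only [hypergeomSeries, coeff_mk]
  exact h.ge

theorem ordinaryHypergeometric_eq_seriesSum (a b c : ℝ) :
    (ordinaryHypergeometric a b c : ℝ → ℝ) = seriesSum (hypergeomSeries a b c) := by
  rw [ordinaryHypergeometric_eq_tsum]
  funext x
  exact tsum_congr fun n => by
    rw [hypergeomSeries, coeff_mk, smul_eq_mul]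

theorem unitConvergent_reducedLogDeriv {V : ℝ⟦X⟧} (hV : UnitConvergent V)
    (h1 : coeff 0 V = 1) (hpos : ∀ n, 0 < coeff n V)
    (h0 : 0 ≤ coeff 0 (reducedLogDeriv V)) (hneg : ∀ n, coeff (n + 1) (reducedLogDeriv V) ≤ 0) :
    UnitConvergent (reducedLogDeriv V) := by
  intro x hx
  have s1 := (hV x hx).mul_left (coeff 0 (reducedLogDeriv V))
  have s2 := (unitConvergent_X.mul hV.derivative_and_hasDerivAt.1).1 x hx
  refine (s1.add s2).of_nonneg_of_le (fun _ => norm_nonneg _) fun n => ?_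
  have h := abs_coeff_reducedLogDeriv_le h1 hpos h0 hneg n
  rw [coeff_X_mul_derivative]
  simp only [norm_mul, Real.norm_eq_abs, abs_of_pos (hpos n), Nat.abs_cast]
  calc _ ≤ _ := mul_le_mul_of_nonneg_right h (abs_nonneg (x ^ n))
    _ = _ := by ring

/-- With the integrating factor, `v * exp (-∫ K)` is constant, so a single zero would make `v`
vanish at `x₀` too. -/
theorem ne_zero_of_hasDerivAt_linear {v K : ℝ → ℝ} {s t : ℝ} (hK : ContinuousOn K (Set.Ioo s t))
    (hv : ∀ x ∈ Set.Ioo s t, HasDerivAt v (K x * v x) x) {x₀ : ℝ} (hx₀ : x₀ ∈ Set.Ioo s t)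
    (h₀ : v x₀ ≠ 0) {x : ℝ} (hx : x ∈ Set.Ioo s t) : v x ≠ 0 := by
  have hI : ∀ y ∈ Set.Ioo s t, HasDerivAt (fun y => ∫ u in x₀..y, K u) (K y) y := by
    intro y hy
    have hsub : Set.uIcc x₀ y ⊆ Set.Ioo s t := Set.ordConnected_Ioo.uIcc_subset hx₀ hy
    refine intervalIntegral.integral_hasDerivAt_right ((hK.mono hsub).intervalIntegrable)
      ?_ (hK.continuousAt (isOpen_Ioo.mem_nhds hy))
    exact hK.stronglyMeasurableAtFilter isOpen_Ioo y hy
  have hD : ∀ y ∈ Set.Ioo s t,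
      HasDerivAt (fun y => v y * Real.exp (-∫ u in x₀..y, K u)) 0 y := by
    intro y hy
    have := (hv y hy).mul (hI y hy).neg.exp
    convert! this using 1
    simp only [Pi.neg_apply]
    ring
  have hconst := isOpen_Ioo.is_const_of_deriv_eq_zero isPreconnected_Ioo
    (fun y hy => (hD y hy).differentiableAt.differentiableWithinAt)
    (fun y hy => (hD y hy).deriv) hx hx₀
  intro hzero
  simp [hzero] at hconst
  exact h₀ hconst.symm

/-- Terms of degree at most one are affine, those of higher degree are concave, and the quadratic
term makes the inequality strict. -/
theorem strictConcaveOn_seriesSum {P : ℝ⟦X⟧} (hP : UnitConvergent P)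
    (h2 : coeff 2 P < 0) (hn : ∀ n, 2 ≤ n → coeff n P ≤ 0) :
    StrictConcaveOn ℝ (Set.Ioo (0 : ℝ) 1) (seriesSum P) := by
  have abs_lt : ∀ x ∈ Set.Ioo (0 : ℝ) 1, |x| < 1 := fun x hx => by
    rw [abs_of_pos hx.1]; exact hx.2
  refine ⟨convex_Ioo 0 1, fun x hx y hy hxy s t hs ht hst => ?_⟩
  have hz := convex_Ioo (0 : ℝ) 1 hx hy hs.le ht.le hst
  refine hasSum_lt (i := 2) (fun n => ?_) ?_
    (((hP.hasSum (abs_lt x hx)).const_smul s).add ((hP.hasSum (abs_lt y hy)).const_smul t))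
    (hP.hasSum (abs_lt _ hz))
  · simp only [smul_eq_mul]
    have hcomb : s * (coeff n P * x ^ n) + t * (coeff n P * y ^ n) =
      coeff n P * (s * x ^ n + t * y ^ n) := by ring
    rw [hcomb]
    match n with
    | 0 => simp [hst]
    | 1 => simp
    | k + 2 =>
      have h := (convexOn_pow (𝕜 := ℝ) (k + 2)).2 hx.1.le hy.1.le hs.le ht.le hst
      simp only [smul_eq_mul] at h
      exact mul_le_mul_of_nonpos_left h (hn _ (by omega))
  · simp only [smul_eq_mul]
    -- This is the convexity gap of the square: `s x² + t y² - (s x + t y)²` when `s + t = 1`.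
    have h : 0 < s * t * (x - y) ^ 2 := by
      have := sq_pos_of_ne_zero (sub_ne_zero.2 hxy)
      positivity
    obtain rfl : t = 1 - s := by linarith
    nlinarith [mul_pos (neg_pos.2 h2) h]

/-- On `(-1, 1)` the scaled logarithmic derivative of a power series `V` is the sum of the power
series `X (1 - X) V' / V`. -/
theorem scaledLogDeriv_seriesSum {V : ℝ⟦X⟧} (hV : UnitConvergent V) (h1 : coeff 0 V = 1)
    (hH : UnitConvergent (reducedLogDeriv V)) {x : ℝ} (hx : |x| < 1) :
    scaledLogDeriv (seriesSum V) x = seriesSum (X * reducedLogDeriv V) x := by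
  have hode : ∀ y : ℝ, |y| < 1 →
      seriesSum (reducedLogDeriv V) y * seriesSum V y = (1 - y) * deriv (seriesSum V) y := by
    intro y hy
    rw [← (hH.mul hV).2 y hy, reducedLogDeriv_mul_self h1,
      (unitConvergent_one_sub_X.mul hV.derivative_and_hasDerivAt.1).2 y hy, seriesSum_one_sub_X,
      (hV.derivative_and_hasDerivAt.2 y hy).deriv]
  -- For negative `x`, positivity of the coefficients does not exclude a zero; the linear equation
  -- `v' = (H / (1 - y)) v` with `v 0 = 1` does.
  have hne : seriesSum V x ≠ 0 := by
    refine ne_zero_of_hasDerivAt_linear (s := -1) (t := 1) (x₀ := 0)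
      (K := fun y => seriesSum (reducedLogDeriv V) y / (1 - y)) ?_ ?_ (by simp) ?_ (abs_lt.1 hx)
    · refine ContinuousOn.div (fun y hy => ?_) (by fun_prop) fun y hy => (sub_pos.2 hy.2).ne'
      exact (hH.analyticAt (abs_lt.2 hy)).continuousAt.continuousWithinAt
    · intro y hy
      have h := (hV.derivative_and_hasDerivAt.2 y (abs_lt.2 hy)).differentiableAt.hasDerivAt
      have h' := hode y (abs_lt.2 hy)
      have hy' : 1 - y ≠ 0 := (sub_pos.2 hy.2).ne'
      convert! h using 1
      field_simp
      linear_combination h'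
    · rw [seriesSum_zero, h1]
      exact one_ne_zero
  rw [(unitConvergent_X.mul hH).2 x hx, seriesSum_X, scaledLogDeriv]
  have h := hode x hx
  field_simp
  linear_combination -x * h

/-! ### Positivity, reflection about `1/2` and monotonicity -/

theorem symLogDeriv_eq_add (v : ℝ → ℝ) (x : ℝ) :
    symLogDeriv v x = scaledLogDeriv v x + scaledLogDeriv v (1 - x) := by
  simp only [symLogDeriv, scaledLogDeriv]
  ring

theorem scaledLogDeriv_pos {V : ℝ⟦X⟧} (hV : UnitConvergent V) (hpos : ∀ n, 0 < coeff n V)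
    {x : ℝ} (hx : x ∈ Set.Ioo (0 : ℝ) 1) : 0 < scaledLogDeriv (seriesSum V) x := by
  have hx' : |x| < 1 := by rw [abs_of_pos hx.1]; exact hx.2
  have hx0 := hx.1
  have hx1 : 0 < 1 - x := sub_pos.2 hx.2
  have h1 : 0 < seriesSum V x :=
    (hV x hx').of_norm.tsum_pos (fun n => (mul_pos (hpos n) (pow_pos hx.1 n)).le) 0
      (by simpa using hpos 0)
  have hd := hV.derivative_and_hasDerivAt
  have h2' : ∀ n, 0 < coeff n (d⁄dX ℝ V) * x ^ n := fun n => by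
    rw [coeff_derivative]
    have := hpos (n + 1)
    positivity
  have h2 : 0 < deriv (seriesSum V) x := by
    rw [(hd.2 x hx').deriv]
    exact (hd.1 x hx').of_norm.tsum_pos (fun n => (h2' n).le) 0 (h2' 0)
  unfold scaledLogDeriv
  positivity

theorem StrictConcaveOn.add_reflect {f : ℝ → ℝ} (hf : StrictConcaveOn ℝ (Set.Ioo (0 : ℝ) 1) f) :
    StrictConcaveOn ℝ (Set.Ioo (0 : ℝ) 1) (fun x => f x + f (1 - x)) := by
  refine hf.add ⟨convex_Ioo 0 1, fun x hx y hy hxy s t hs ht hst => ?_⟩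
  have h := hf.2 (x := 1 - x) (y := 1 - y) ⟨by linarith [hx.2], by linarith [hx.1]⟩
    ⟨by linarith [hy.2], by linarith [hy.1]⟩ (fun h => hxy (by linarith)) hs ht hst
  have e : s • (1 - x) + t • (1 - y) = 1 - (s • x + t • y) := by
    simp only [smul_eq_mul]
    linear_combination hst
  rwa [e] at h

/-- If `x < y ≤ 1/2`, then `y` lies strictly between `x` and `1 - x`, where `g` takes equal values;
strict concavity puts `g y` above them. -/
theorem StrictConcaveOn.strictMonoOn_of_reflect {g : ℝ → ℝ}
    (hg : StrictConcaveOn ℝ (Set.Ioo (0 : ℝ) 1) g)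
    (hsymm : ∀ x ∈ Set.Ioo (0 : ℝ) 1, g (1 - x) = g x) :
    StrictMonoOn g (Set.Ioc (0 : ℝ) (1 / 2)) := by
  intro x hx y hy hxy
  have hxI : x ∈ Set.Ioo (0 : ℝ) 1 := ⟨hx.1, by linarith [hx.2]⟩
  have h := hg.lt_on_openSegment hxI (y := 1 - x) ⟨by linarith [hxI.2], by linarith [hxI.1]⟩
    (by linarith [hy.2] : x < 1 - x).ne (z := y) (by
      rw [openSegment_eq_Ioo (by linarith [hy.2])]
      exact ⟨hxy, by linarith [hy.2]⟩)
  rwa [hsymm x hxI, min_self] at h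

theorem strictAntiOn_of_strictMonoOn_of_reflect {g : ℝ → ℝ}
    (hg : StrictMonoOn g (Set.Ioc (0 : ℝ) (1 / 2)))
    (hsymm : ∀ x ∈ Set.Ioo (0 : ℝ) 1, g (1 - x) = g x) :
    StrictAntiOn g (Set.Ico (1 / 2 : ℝ) 1) := by
  intro x hx y hy hxy
  rw [← hsymm x ⟨by linarith [hx.1], hx.2⟩, ← hsymm y ⟨by linarith [hy.1], hy.2⟩]
  exact hg ⟨by linarith [hy.2], by linarith [hy.1]⟩ ⟨by linarith [hx.2], by linarith [hx.1]⟩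
    (by linarith)

/-! ### Application to the hypergeometric function -/

theorem unitConvergent_reducedLogDeriv_hypergeomSeries {a b c : ℝ} (ha : 0 < a) (hb : 0 < b)
    (hc : 0 < c) (hneg : ∀ n, coeff (n + 1) (reducedLogDeriv (hypergeomSeries a b c)) ≤ 0) :
    UnitConvergent (reducedLogDeriv (hypergeomSeries a b c)) :=
  unitConvergent_reducedLogDeriv (unitConvergent_hypergeomSeries ha hb hc)
    (coeff_hypergeomSeries_zero a b c) (coeff_hypergeomSeries_pos ha hb hc)
    (by rw [coeff_reducedLogDeriv_zero hc]; positivity) hneg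

theorem mainTheorem7 (a b c : ℝ) (ha : 0 < a) (hb : 0 < b) (hc : 0 < c)
    (v : ℝ → ℝ) (hv : v = ordinaryHypergeometric a b c) :
    (max a b < c →
      -- `f(x) = x(1-x)v'(x)/v(x)` is the sum of its Maclaurin series, with the stated signs
      ((∀ x ∈ Set.Ioo (-1 : ℝ) 1,
          HasSum (fun n : ℕ => maclaurinCoeff (scaledLogDeriv v) n * x ^ n)
            (scaledLogDeriv v x)) ∧
        maclaurinCoeff (scaledLogDeriv v) 0 = 0 ∧
        0 < maclaurinCoeff (scaledLogDeriv v) 1 ∧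
        (∀ n : ℕ, 2 ≤ n → maclaurinCoeff (scaledLogDeriv v) n < 0) ∧
        (∀ x ∈ Set.Ioo (0 : ℝ) 1, 0 < scaledLogDeriv v x) ∧
        StrictConcaveOn ℝ (Set.Ioo (0 : ℝ) 1) (scaledLogDeriv v)) ∧
      -- the properties of `N`
      ((∀ x ∈ Set.Ioo (0 : ℝ) 1, 0 < symLogDeriv v x) ∧
        (∀ x ∈ Set.Ioo (0 : ℝ) 1, symLogDeriv v (1 - x) = symLogDeriv v x) ∧
        StrictConcaveOn ℝ (Set.Ioo (0 : ℝ) 1) (symLogDeriv v) ∧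
        StrictMonoOn (symLogDeriv v) (Set.Ioc (0 : ℝ) (1 / 2)) ∧
        StrictAntiOn (symLogDeriv v) (Set.Ico (1 / 2 : ℝ) 1))) ∧
    (max a b = c →
      ∃ C : ℝ, 0 < C ∧ ∀ x ∈ Set.Ioo (0 : ℝ) 1, symLogDeriv v x = C) := by
  have hv' : v = seriesSum (hypergeomSeries a b c) := by
    rw [hv, ordinaryHypergeometric_eq_seriesSum]
  have hV := unitConvergent_hypergeomSeries ha hb hc
  have h0 := coeff_hypergeomSeries_zero a b c
  have hA1 : 0 < a * b / c := by positivity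
  have hpos : ∀ x ∈ Set.Ioo (0 : ℝ) 1, 0 < scaledLogDeriv v x := fun x hx => by
    rw [hv']
    exact scaledLogDeriv_pos hV (coeff_hypergeomSeries_pos ha hb hc) hx
  have hrefl : ∀ x ∈ Set.Ioo (0 : ℝ) 1, 1 - x ∈ Set.Ioo (0 : ℝ) 1 := fun x hx =>
    ⟨by linarith [hx.2], by linarith [hx.1]⟩
  constructor
  · intro h
    have hneg := coeff_reducedLogDeriv_neg ha hb hc ((le_max_left a b).trans_lt h)
      ((le_max_right a b).trans_lt h)
    have hH := unitConvergent_reducedLogDeriv_hypergeomSeries ha hb hc fun n => (hneg n).le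
    have hXH := (unitConvergent_X.mul hH).1
    have heq : ∀ x ∈ Set.Ioo (-1 : ℝ) 1, scaledLogDeriv v x =
        seriesSum (X * reducedLogDeriv (hypergeomSeries a b c)) x := fun x hx => by
      rw [hv', scaledLogDeriv_seriesSum hV h0 hH (abs_lt.2 hx)]
    have hcoeff := hXH.maclaurinCoeff_eq heq
    have hneg' : ∀ n, 2 ≤ n →
        coeff n (X * reducedLogDeriv (hypergeomSeries a b c)) < 0 := by
      intro n hn
      obtain ⟨k, rfl⟩ := Nat.exists_eq_add_of_le' hn
      rw [coeff_succ_X_mul]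
      exact hneg k
    have hconc : StrictConcaveOn ℝ (Set.Ioo (0 : ℝ) 1) (scaledLogDeriv v) :=
      (strictConcaveOn_seriesSum hXH (hneg' 2 le_rfl) fun n hn => (hneg' n hn).le).congr
        fun x hx => (heq x ⟨by linarith [hx.1], hx.2⟩).symm
    have hN : symLogDeriv v = fun x => scaledLogDeriv v x + scaledLogDeriv v (1 - x) :=
      funext (symLogDeriv_eq_add v)
    have hNconc : StrictConcaveOn ℝ (Set.Ioo (0 : ℝ) 1) (symLogDeriv v) :=
      hN ▸ hconc.add_reflect
    have hsymm : ∀ x ∈ Set.Ioo (0 : ℝ) 1, symLogDeriv v (1 - x) = symLogDeriv v x := by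
      intro x _
      rw [symLogDeriv_eq_add, symLogDeriv_eq_add, sub_sub_cancel, add_comm]
    have hmono := hNconc.strictMonoOn_of_reflect hsymm
    refine ⟨⟨fun x hx => ?_, ?_, ?_, fun n hn => ?_, hpos, hconc⟩, fun x hx => ?_, hsymm, hNconc,
      hmono, strictAntiOn_of_strictMonoOn_of_reflect hmono hsymm⟩
    · simp only [hcoeff, heq x hx]
      exact hXH.hasSum (abs_lt.2 hx)
    · rw [hcoeff, coeff_zero_X_mul]
    · rw [hcoeff, ← zero_add 1, coeff_succ_X_mul, coeff_reducedLogDeriv_zero hc]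
      exact hA1
    · rw [hcoeff]
      exact hneg' n hn
    · rw [symLogDeriv_eq_add]
      exact add_pos (hpos x hx) (hpos _ (hrefl x hx))
  · intro h
    have hzero := coeff_reducedLogDeriv_eq_zero hc h
    have hH := unitConvergent_reducedLogDeriv_hypergeomSeries ha hb hc fun n => (hzero n).le
    have heq : ∀ x ∈ Set.Ioo (0 : ℝ) 1, scaledLogDeriv v x = x * (a * b / c) := fun x hx => by
      have hx' : |x| < 1 := by rw [abs_of_pos hx.1]; exact hx.2
      rw [hv', scaledLogDeriv_seriesSum hV h0 hH hx', (unitConvergent_X.mul hH).2 x hx',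
        seriesSum_X, seriesSum, tsum_eq_single 0, coeff_reducedLogDeriv_zero hc, pow_zero, mul_one]
      intro n hn
      obtain ⟨k, rfl⟩ := Nat.exists_eq_succ_of_ne_zero hn
      rw [Nat.succ_eq_add_one, hzero, zero_mul]
    refine ⟨a * b / c, hA1, fun x hx => ?_⟩
    rw [symLogDeriv_eq_add, heq x hx, heq _ (hrefl x hx)]
    ring
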